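/- Let $d\ge 0$ and, for each direction $k=1,\dots,d$, let $p_k\ge 0$ be a degree, $n_k$ a dimension, and $\Xi_k=(\xi_{k,1}\le\dots\le\xi_{k,n_k+p_k+1})$ a non-decreasing knot vector with $\xi_{k,p_k+1}=0$ and $\xi_{k,n_k+1}=1$ (for example an open knot vector on $[0,1]$). Let $\hat B_{k,1},\dots,\hat B_{k,n_k}$ be the B-splines of degree $p_k$ on $\Xi_k$ given by the Cox–de Boor recursion (with the convention $\cdot/0=0$), starting from the indicator functions of the half-open knot spans, with the left limit taken at the right end point $1$. For a multi-index $i=(i_1,\dots,i_d)$ with $1\le i_k\le n_k$ put $\hat B_i(\hat x)=\prod_{k=1}^d\hat B_{k,i_k}(\hat x_k)$ for $\hat x\in[0,1]^d$. Let the single-patch geometry map $F:[0,1]^d\to\mathbb R^d$ be injective, and let $B_i=\hat B_i\circ F^{-1}$ on $F([0,1]^d)$. Let $\hat x_{k,1},\dots,\hat x_{k,n_k}\in[0,1]$ be given in each direction, and assume that the tensor-product interpolation points $x_i=F(\hat x_{1,i_1},\dots,\hat x_{d,i_d})$ are pairwise distinct. Let $A$ be the collocation matrix $A_{ij}=B_j(x_i)$,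 with rows and columns indexed by the multi-indices. Then: 1. If $B_i(x_i)>0$ for every $i$, then $A$ is invertible. 2. If the points are numbered in increasing order in each direction, i.e. $\hat x_{k,1}\le\dots\le\hat x_{k,n_k}$ for every $k$, then $A$ is invertible if and only if $B_i(x_i)>0$ for every $i$. -/

import Mathlib

noncomputable section

namespace TensorSpline

/-- A knot vector of degree `p` for an `n`-dimensional univariate spline space on the parametric
interval `[0, 1]`: a non-decreasing sequence of `n + p + 1` real numbers (numbered from `0`), whose
`p`-th and `n`-th entries are the end points of the parametric interval. Every clamped (open) knot
vector is of this kind, with its first `p + 1` knots equal to `0` and its last `p + 1` equal to `1`.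
The inequality `p + 1 ≤ n` follows from the fields. -/
structure KnotVector (p n : ℕ) where
  /-- the knots -/
  knot : Fin (n + p + 1) → ℝ
  monotone_knot : Monotone knot
  knot_left : knot ⟨p, by omega⟩ = 0
  knot_right : knot ⟨n, by omega⟩ = 1

/-- The knots as a sequence on `ℕ`; the values beyond the last knot (all equal to the last knot)
never enter the B-splines with index below `n`. -/
def KnotVector.seq {p n : ℕ} (Ξ : KnotVector p n) (m : ℕ) : ℝ :=
  Ξ.knot ⟨min m (n + p), by omega⟩

/-- The Cox--de Boor recursion on `[0, 1]`: `coxDeBoor t q i x` is the value at `x` of the `i`-th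
B-spline of degree `q` on the knots `t`. Quotients with denominator `0` count as `0`, as is usual
(and as in Lean). The degree zero functions are the indicator functions of the half-open knot spans
`[t i, t (i + 1))`, except at the right end point `1` of the interval, where the left limit is
taken, so that the B-splines are continuous from the left there. -/
def coxDeBoor (t : ℕ → ℝ) : ℕ → ℕ → ℝ → ℝ
  | 0, i, x =>
      open Classical in
      if (x ≠ 1 ∧ t i ≤ x ∧ x < t (i + 1)) ∨ (x = 1 ∧ t i < x ∧ x ≤ t (i + 1)) then 1 else 0
  | q + 1, i, x =>
      (x - t i) / (t (i + q + 1) - t i) * coxDeBoor t q i x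
        + (t (i + q + 2) - x) / (t (i + q + 2) - t (i + 1)) * coxDeBoor t q (i + 1) x

/-- The univariate B-spline with index `j` on the knot vector `Ξ`. -/
def KnotVector.bspline {p n : ℕ} (Ξ : KnotVector p n) (j : Fin n) (x : ℝ) : ℝ :=
  coxDeBoor Ξ.seq p j x

variable {d : ℕ} {p n : Fin d → ℕ}

/-- The tensor-product B-spline with multi-index `i` on the parametric domain `[0, 1]^d`. -/
def paramBasis (Ξ : ∀ k, KnotVector (p k) (n k)) (i : ∀ k, Fin (n k)) (u : Fin d → ℝ) : ℝ :=
  ∏ k, (Ξ k).bspline (i k) (u k)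

/-- The basis function `B_i ∘ F⁻¹` on the physical domain `F([0, 1]^d)`, where `F⁻¹` is the inverse
of the restriction of the geometry map `F` to `[0, 1]^d`. -/
def physBasis (Ξ : ∀ k, KnotVector (p k) (n k)) (F : (Fin d → ℝ) → (Fin d → ℝ))
    (i : ∀ k, Fin (n k)) (y : Fin d → ℝ) : ℝ :=
  paramBasis Ξ i (Function.invFunOn F (Set.Icc 0 1) y)

/-- The interpolation point with multi-index `i` on the physical domain: the image under `F` of the
point of the tensor-product grid with coordinates `ξ k (i k)`. -/
def interpPoint (F : (Fin d → ℝ) → (Fin d → ℝ)) (ξ : ∀ k, Fin (n k) → ℝ)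
    (i : ∀ k, Fin (n k)) : Fin d → ℝ :=
  F (fun k => ξ k (i k))

/-- The collocation matrix with entries `B_j(x_i)`, for arbitrary functions and points. -/
def collocationMatrix {ι X : Type*} (B : ι → X → ℝ) (x : ι → X) : Matrix ι ι ℝ :=
  Matrix.of fun i j => B j (x i)

end TensorSpline

end

noncomputable section

namespace TensorSpline

/-! Since `F` is injective on the cube, the collocation matrix is the Kronecker product of the
univariate collocation matrices (`collocationMatrix_eq_tensorMatrix`). It is invertible exactly when
every factor is, and the diagonal condition also splits by direction because B-splines are
nonnegative. This leaves the univariate Schoenberg-Whitney theorem.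

Necessity: a nonzero determinant has a nonzero Leibniz term, hence a permutation matching points to
B-splines that do not vanish there. As supports move to the right with the index, sorted points may
be matched by the identity (`inSupport_of_perm`).

Sufficiency (`splineMatrix_det_pos`): by Boehm's formula each B-spline is a nonnegative combination
of two neighbours on the refined knots, so each minor is a nonnegative combination of refined minors
(`splineMatrix_det_eq_sum`). Knots are inserted until every point is a knot of multiplicity at least
`q + 1`; there the minors are zero or those of positive diagonal matrices. A positive diagonal can
be followed through every insertion, so some term stays positive. -/

/-! ### Positivity of B-splines -/

/-- The knot `τ` lies to the left of the evaluation point `x`, where `x` is approached from the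
right unless `x = 1`. -/
def Below (x τ : ℝ) : Prop := τ < x ∨ (τ = x ∧ x ≠ 1)

theorem Below.le {x τ : ℝ} (h : Below x τ) : τ ≤ x := by
  rcases h with h | h
  · exact h.le
  · exact h.1.le

theorem below_of_lt {x τ : ℝ} (h : τ < x) : Below x τ := Or.inl h

theorem not_below_of_lt {x τ : ℝ} (h : x < τ) : ¬ Below x τ := fun h' => (h.trans_le h'.le).false

theorem le_of_not_below {x τ : ℝ} (h : ¬ Below x τ) : x ≤ τ :=
  le_of_not_gt fun h' => h (below_of_lt h')

theorem Below.mono {x y τ σ : ℝ} (h : Below x τ) (hxy : x ≤ y) (hστ : σ ≤ τ) : Below y σ := by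
  rcases hxy.eq_or_lt with rfl | hxy
  · rcases h with h | ⟨rfl, h⟩
    · exact Or.inl (hστ.trans_lt h)
    · rcases hστ.eq_or_lt with rfl | h'
      · exact Or.inr ⟨rfl, h⟩
      · exact Or.inl h'
  · exact Or.inl ((hστ.trans h.le).trans_lt hxy)

/-- The part of the support condition of a B-spline which concerns its left end. -/
def RightOfStart (t : ℕ → ℝ) (q i : ℕ) (x : ℝ) : Prop :=
  Below x (t i) ∧ (t i < x ∨ Below x (t (i + q)))

/-- The part of the support condition of a B-spline which concerns its right end. -/
def LeftOfEnd (t : ℕ → ℝ) (q i : ℕ) (x : ℝ) : Prop :=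
  ¬ Below x (t (i + q + 1)) ∧ (x < t (i + q + 1) ∨ ¬ Below x (t (i + 1)))

/-- The set of points at which a B-spline is positive. -/
def InSupport (t : ℕ → ℝ) (q i : ℕ) (x : ℝ) : Prop :=
  RightOfStart t q i x ∧ LeftOfEnd t q i x

/-- The two halves of the support condition are monotone in opposite directions; this is what allows
a matching of points and B-splines to be rearranged. -/
theorem RightOfStart.mono {t : ℕ → ℝ} (ht : Monotone t) {q i j : ℕ} {x y : ℝ}
    (h : RightOfStart t q i x) (hij : j ≤ i) (hxy : x ≤ y) : RightOfStart t q j y :=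
  ⟨h.1.mono hxy (ht hij), h.2.imp (fun h' => ((ht hij).trans_lt h').trans_le hxy)
    fun h' => h'.mono hxy (ht (by omega))⟩

theorem LeftOfEnd.mono {t : ℕ → ℝ} (ht : Monotone t) {q i j : ℕ} {x y : ℝ}
    (h : LeftOfEnd t q i x) (hij : i ≤ j) (hxy : y ≤ x) : LeftOfEnd t q j y :=
  ⟨fun h' => h.1 (h'.mono hxy (ht (by omega))),
    h.2.imp (fun h' => (hxy.trans_lt h').trans_le (ht (by omega)))
      fun h' h'' => h' (h''.mono hxy (ht (by omega)))⟩

/-- This mirrors the Cox-de Boor recursion. The second alternatives in `RightOfStart` and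
`LeftOfEnd` matter only at an end of the support, where the B-spline is nonzero only if `q + 1`
knots of that end coincide. -/
theorem inSupport_succ {t : ℕ → ℝ} (ht : Monotone t) (q i : ℕ) (x : ℝ) :
    InSupport t (q + 1) i x ↔
      (t i < x ∧ InSupport t q i x) ∨ (x < t (i + q + 2) ∧ InSupport t q (i + 1) x) := by
  have e1 : i + (q + 1) = i + q + 1 := by omega
  have e2 : i + 1 + q = i + q + 1 := by omega
  have e3 : i + (q + 1) + 1 = i + q + 2 := by omega
  have e4 : i + q + 1 + 1 = i + q + 2 := by omega
  simp only [InSupport, RightOfStart, LeftOfEnd, e1, e2, e4]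
  have m1 : t i ≤ t (i + 1) := ht (by omega)
  have m2 : t (i + 1) ≤ t (i + q + 1) := ht (by omega)
  have m3 : t (i + q + 1) ≤ t (i + q + 2) := ht (by omega)
  constructor
  · rintro ⟨⟨h1, h3⟩, h2, h4⟩
    by_cases hD : Below x (t (i + 1))
    · have hx : x < t (i + q + 2) := h4.resolve_right (not_not.2 hD)
      by_cases hE : Below x (t (i + q + 1))
      · exact Or.inr ⟨hx, ⟨hD, Or.inr hE⟩, h2, Or.inl hx⟩
      · have hi : t i < x := h3.resolve_right hE
        by_cases hF : x < t (i + q + 1)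
        · exact Or.inl ⟨hi, ⟨h1, Or.inl hi⟩, hE, Or.inl hF⟩
        · by_cases hG : t (i + 1) < x
          · exact Or.inr ⟨hx, ⟨hD, Or.inl hG⟩, h2, Or.inl hx⟩
          · exact absurd (hD.mono le_rfl (by linarith)) hE
    · have hE : ¬ Below x (t (i + q + 1)) := fun h => hD (h.mono le_rfl m2)
      have hi : t i < x := h3.resolve_right hE
      exact Or.inl ⟨hi, ⟨h1, Or.inl hi⟩, hE, Or.inr hD⟩
  · rintro (⟨hi, ⟨h1, h3⟩, h2, h4⟩ | ⟨hx, ⟨h1, h3⟩, h2, h4⟩)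
    · exact ⟨⟨h1, Or.inl hi⟩, fun h => h2 (h.mono le_rfl m3), h4.imp (fun h => h.trans_le m3) id⟩
    · exact ⟨⟨h1.mono le_rfl m1, h3.imp (fun h => m1.trans_lt h) id⟩, h2, Or.inl hx⟩

/-- A weight of the recursion can be negative only where the B-spline it multiplies vanishes, so the
two summands never cancel. -/
theorem coxDeBoor_pos_or_eq_zero {t : ℕ → ℝ} (ht : Monotone t) (x : ℝ) (q : ℕ) : ∀ i,
    (InSupport t q i x ∧ 0 < coxDeBoor t q i x) ∨
      (¬ InSupport t q i x ∧ coxDeBoor t q i x = 0) := by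
  induction q with
  | zero =>
    intro i
    have key : InSupport t 0 i x ↔
        ((x ≠ 1 ∧ t i ≤ x ∧ x < t (i + 1)) ∨ (x = 1 ∧ t i < x ∧ x ≤ t (i + 1))) := by
      simp only [InSupport, RightOfStart, LeftOfEnd, Below, add_zero]
      by_cases hx : x = 1
      · simp only [hx, ne_eq, not_true, and_false, or_false, not_lt]
        grind
      · simp only [hx, ne_eq, not_false_iff, and_true, not_or, not_lt, false_and, or_false,
          true_and]
        grind
    by_cases h : InSupport t 0 i x
    · left
      refine ⟨h, ?_⟩
      rw [coxDeBoor, if_pos (key.1 h)]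
      exact one_pos
    · right
      refine ⟨h, ?_⟩
      rw [coxDeBoor, if_neg (fun h' => h (key.2 h'))]
  | succ q ih =>
    intro i
    have first : (t i < x ∧ InSupport t q i x ∧
          0 < (x - t i) / (t (i + q + 1) - t i) * coxDeBoor t q i x) ∨
        (¬ (t i < x ∧ InSupport t q i x) ∧
          (x - t i) / (t (i + q + 1) - t i) * coxDeBoor t q i x = 0) := by
      rcases ih i with ⟨h, hpos⟩ | ⟨h, h0⟩
      · rcases h.1.1.le.eq_or_lt with he | hl
        · right
          simp [he]
        · left
          have := le_of_not_below h.2.1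
          exact ⟨hl, h, mul_pos (div_pos (by linarith) (by linarith)) hpos⟩
      · right
        simp [h, h0]
    have second : (x < t (i + q + 2) ∧ InSupport t q (i + 1) x ∧
          0 < (t (i + q + 2) - x) / (t (i + q + 2) - t (i + 1)) * coxDeBoor t q (i + 1) x) ∨
        (¬ (x < t (i + q + 2) ∧ InSupport t q (i + 1) x) ∧
          (t (i + q + 2) - x) / (t (i + q + 2) - t (i + 1)) * coxDeBoor t q (i + 1) x = 0) := by
      rcases ih (i + 1) with ⟨h, hpos⟩ | ⟨h, h0⟩
      · have h2 := le_of_not_below h.2.1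
        rw [show i + 1 + q + 1 = i + q + 2 by omega] at h2
        rcases h2.eq_or_lt with he | hl
        · right
          simp [he]
        · left
          have := h.1.1.le
          exact ⟨hl, h, mul_pos (div_pos (by linarith) (by linarith)) hpos⟩
      · right
        simp [h, h0]
    rw [inSupport_succ ht, coxDeBoor]
    rcases first with ⟨h1, h2, h3⟩ | ⟨h1, h2⟩ <;> rcases second with ⟨k1, k2, k3⟩ | ⟨k1, k2⟩
    · exact Or.inl ⟨Or.inl ⟨h1, h2⟩, add_pos h3 k3⟩
    · exact Or.inl ⟨Or.inl ⟨h1, h2⟩, by rw [k2, add_zero]; exact h3⟩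
    · exact Or.inl ⟨Or.inr ⟨k1, k2⟩, by rw [h2, zero_add]; exact k3⟩
    · exact Or.inr ⟨not_or.2 ⟨h1, k1⟩, by rw [h2, k2, add_zero]⟩

theorem coxDeBoor_pos_iff {t : ℕ → ℝ} (ht : Monotone t) {q i : ℕ} {x : ℝ} :
    0 < coxDeBoor t q i x ↔ InSupport t q i x := by
  rcases coxDeBoor_pos_or_eq_zero ht x q i with ⟨h, h'⟩ | ⟨h, h'⟩ <;> simp [h, h']

theorem coxDeBoor_nonneg {t : ℕ → ℝ} (ht : Monotone t) (q i : ℕ) (x : ℝ) :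
    0 ≤ coxDeBoor t q i x := by
  rcases coxDeBoor_pos_or_eq_zero ht x q i with ⟨_, h⟩ | ⟨_, h⟩
  · exact h.le
  · exact h.ge

theorem coxDeBoor_ne_zero_iff {t : ℕ → ℝ} (ht : Monotone t) {q i : ℕ} {x : ℝ} :
    coxDeBoor t q i x ≠ 0 ↔ InSupport t q i x := by
  rw [← coxDeBoor_pos_iff ht, (coxDeBoor_nonneg ht q i x).lt_iff_ne']

theorem coxDeBoor_eq_zero_of_knot_eq {t : ℕ → ℝ} (ht : Monotone t) {q i : ℕ} {x : ℝ}
    (h : t (i + q + 1) ≤ t i) : coxDeBoor t q i x = 0 := by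
  by_contra h0
  have := (coxDeBoor_ne_zero_iff ht).1 h0
  exact this.2.1 (this.1.1.mono le_rfl h)

theorem coxDeBoor_congr {t u : ℕ → ℝ} (x : ℝ) (q : ℕ) : ∀ i,
    (∀ k, k ≤ i + q + 1 → t k = u k) → coxDeBoor t q i x = coxDeBoor u q i x := by
  induction q with
  | zero =>
    intro i h
    simp only [coxDeBoor, h i (by omega), h (i + 1) (by omega)]
  | succ q ih =>
    intro i h
    simp only [coxDeBoor, h i (by omega), h (i + 1) (by omega), h (i + q + 1) (by omega),
      h (i + q + 2) (by omega), ih i fun k hk => h k (by omega),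
      ih (i + 1) fun k hk => h k (by omega)]

/-! ### Knot insertion -/

/-- The knots `t` with a further knot `z` inserted after the one with index `m`. -/
def insertKnot (t : ℕ → ℝ) (m : ℕ) (z : ℝ) (k : ℕ) : ℝ :=
  if k ≤ m then t k else if k = m + 1 then z else t (k - 1)

theorem insertKnot_of_le {t : ℕ → ℝ} {m : ℕ} {z : ℝ} {k : ℕ} (h : k ≤ m) :
    insertKnot t m z k = t k := if_pos h

theorem insertKnot_self {t : ℕ → ℝ} {m : ℕ} {z : ℝ} : insertKnot t m z (m + 1) = z := by
  simp [insertKnot]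

theorem insertKnot_of_lt {t : ℕ → ℝ} {m : ℕ} {z : ℝ} {k : ℕ} (h : m < k) :
    insertKnot t m z (k + 1) = t k := by
  rw [insertKnot, if_neg (by omega), if_neg (by omega), Nat.add_sub_cancel]

theorem insertKnot_monotone {t : ℕ → ℝ} (ht : Monotone t) {m : ℕ} {z : ℝ} (h1 : t m ≤ z)
    (h2 : z < t (m + 1)) : Monotone (insertKnot t m z) := by
  refine monotone_nat_of_le_succ fun k => ?_
  rcases lt_trichotomy k m with h | rfl | h
  · rw [insertKnot_of_le h.le, insertKnot_of_le h]
    exact ht (Nat.le_succ k)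
  · rw [insertKnot_of_le le_rfl, insertKnot_self]
    exact h1
  · rw [insertKnot_of_lt h]
    obtain ⟨k, rfl⟩ := Nat.exists_eq_succ_of_ne_zero (Nat.ne_zero_of_lt h)
    rcases (Nat.le_of_lt_succ h).eq_or_lt with rfl | h'
    · rw [insertKnot_self]
      exact h2.le
    · rw [insertKnot_of_lt h']
      exact ht (Nat.le_succ k)

/-- The coefficients which express the B-splines on the knots `t` by those on the refined knots. -/
def insertCoeff (t : ℕ → ℝ) (m : ℕ) (z : ℝ) (q i : ℕ) : ℝ :=
  if i + q ≤ m then 1 else if i ≤ m then (z - t i) / (t (i + q) - t i) else 0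

theorem insertCoeff_of_le {t : ℕ → ℝ} {m : ℕ} {z : ℝ} {q i : ℕ} (h : i + q ≤ m) :
    insertCoeff t m z q i = 1 := if_pos h

theorem insertCoeff_of_mid {t : ℕ → ℝ} {m : ℕ} {z : ℝ} {q i : ℕ} (h : i ≤ m) (h' : m < i + q) :
    insertCoeff t m z q i = (z - t i) / (t (i + q) - t i) := by
  rw [insertCoeff, if_neg (by omega), if_pos h]

theorem insertCoeff_of_lt {t : ℕ → ℝ} {m : ℕ} {z : ℝ} {q i : ℕ} (h : m < i) :
    insertCoeff t m z q i = 0 := by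
  rw [insertCoeff, if_neg (by omega), if_neg (by omega)]

theorem insertCoeff_nonneg {t : ℕ → ℝ} (ht : Monotone t) {m : ℕ} {z : ℝ} (h1 : t m ≤ z)
    (q i : ℕ) : 0 ≤ insertCoeff t m z q i := by
  rw [insertCoeff]
  split_ifs with h h'
  · exact zero_le_one
  · have := ht h'
    have := ht (Nat.le_add_right i q)
    exact div_nonneg (by linarith) (by linarith)
  · exact le_rfl

theorem insertCoeff_le_one {t : ℕ → ℝ} (ht : Monotone t) {m : ℕ} {z : ℝ} (h1 : t m ≤ z)
    (h2 : z < t (m + 1)) (q i : ℕ) : insertCoeff t m z q i ≤ 1 := by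
  rw [insertCoeff]
  split_ifs with h h'
  · exact le_rfl
  · have := ht h'
    have := ht (show m + 1 ≤ i + q by omega)
    exact (div_le_one (by linarith)).2 (by linarith)
  · exact zero_le_one

theorem insertCoeff_pos {t : ℕ → ℝ} (ht : Monotone t) {m : ℕ} {z : ℝ}
    (h2 : z < t (m + 1)) {q i : ℕ} (h : t i < z) : 0 < insertCoeff t m z q i := by
  have hi : i ≤ m := by
    by_contra hc
    have := ht (show m + 1 ≤ i by omega)
    linarith
  rw [insertCoeff]
  split_ifs with h'
  · exact zero_lt_one
  · have := ht (show m + 1 ≤ i + q by omega)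
    exact div_pos (by linarith) (by linarith)

theorem insertCoeff_lt_one {t : ℕ → ℝ} (ht : Monotone t) {m : ℕ} {z : ℝ} (h1 : t m ≤ z)
    {q i : ℕ} (h : z < t (i + q)) : insertCoeff t m z q i < 1 := by
  have hi : ¬ i + q ≤ m := fun hc => by
    have := ht hc
    linarith
  rw [insertCoeff, if_neg hi]
  split_ifs with h'
  · have := ht h'
    exact (div_lt_one (by linarith)).2 (by linarith)
  · exact zero_lt_one

/-- This identity and the next two match the coefficients of the refined B-splines in the inductive
step of Boehm's formula. The hypothesis `hlt` excludes zero denominators; without it the refined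
B-spline vanishes. -/
theorem insertCoeff_left {t : ℕ → ℝ} (ht : Monotone t) {m : ℕ} {z : ℝ}
    (h2 : z < t (m + 1)) {q i : ℕ} (x : ℝ)
    (hlt : insertKnot t m z i < insertKnot t m z (i + q + 1)) :
    (x - t i) / (t (i + q + 1) - t i) * insertCoeff t m z q i =
      insertCoeff t m z (q + 1) i * ((x - insertKnot t m z i) /
        (insertKnot t m z (i + q + 1) - insertKnot t m z i)) := by
  rcases lt_or_ge m i with hi | hi
  · rw [insertCoeff_of_lt hi, insertCoeff_of_lt hi]
    ring
  rw [insertKnot_of_le hi] at hlt ⊢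
  have hb := ht hi
  rcases lt_trichotomy (i + q) m with h | h | h
  · rw [insertCoeff_of_le h.le, insertCoeff_of_le (by omega), insertKnot_of_le (by omega)]
    ring
  · rw [h, insertKnot_self] at hlt ⊢
    rw [insertCoeff_of_le h.le, insertCoeff_of_mid hi (by omega), ← add_assoc, h]
    have e1 : t (m + 1) - t i ≠ 0 := by linarith
    have e2 : z - t i ≠ 0 := by linarith
    field_simp
  · rw [insertKnot_of_lt h] at hlt ⊢
    rw [insertCoeff_of_mid hi h, insertCoeff_of_mid hi (by omega), ← add_assoc]
    ring

theorem insertCoeff_right {t : ℕ → ℝ} (ht : Monotone t) {m : ℕ} {z : ℝ} (h1 : t m ≤ z)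
    (h2 : z < t (m + 1)) {q i : ℕ} (x : ℝ)
    (hlt : insertKnot t m z (i + 1) < insertKnot t m z (i + q + 2)) :
    (t (i + q + 1) - x) / (t (i + q + 1) - t i) * (1 - insertCoeff t m z q (i + 1)) =
      (1 - insertCoeff t m z (q + 1) i) * ((insertKnot t m z (i + q + 2) - x) /
        (insertKnot t m z (i + q + 2) - insertKnot t m z (i + 1))) := by
  have e0 : i + 1 + q = i + q + 1 := by omega
  rcases le_or_gt (i + q + 1) m with hi | hi
  · rw [insertCoeff_of_le (by omega), insertCoeff_of_le (by omega)]
    ring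
  rw [insertKnot_of_lt hi] at hlt ⊢
  have hT := ht (show m + 1 ≤ i + q + 1 by omega)
  rcases lt_trichotomy i m with h | h | h
  · rw [insertKnot_of_le h] at hlt ⊢
    rw [insertCoeff_of_mid h (by omega), insertCoeff_of_mid h.le (by omega), e0, ← add_assoc]
    have := ht (Nat.le_succ i)
    simp only [Nat.succ_eq_add_one] at this
    have e1 : t (i + q + 1) - t i ≠ 0 := by linarith
    have e2 : t (i + q + 1) - t (i + 1) ≠ 0 := by linarith
    field_simp
    ring
  · subst h
    rw [insertKnot_self] at hlt ⊢
    rw [insertCoeff_of_lt (by omega), insertCoeff_of_mid le_rfl (by omega), ← add_assoc]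
    have e1 : t (i + q + 1) - t i ≠ 0 := by linarith
    have e2 : t (i + q + 1) - z ≠ 0 := by linarith
    field_simp
    ring
  · rw [insertKnot_of_lt h, insertCoeff_of_lt (by omega), insertCoeff_of_lt h]
    ring

theorem insertCoeff_middle {t : ℕ → ℝ} (ht : Monotone t) {m : ℕ} {z : ℝ} (h1 : t m ≤ z)
    (h2 : z < t (m + 1)) {q i : ℕ} (x : ℝ)
    (hlt : insertKnot t m z (i + 1) < insertKnot t m z (i + q + 2)) :
    (x - t i) / (t (i + q + 1) - t i) * (1 - insertCoeff t m z q (i + 1)) +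
        (t (i + q + 2) - x) / (t (i + q + 2) - t (i + 1)) * insertCoeff t m z q (i + 1) =
      insertCoeff t m z (q + 1) i * ((insertKnot t m z (i + q + 2) - x) /
          (insertKnot t m z (i + q + 2) - insertKnot t m z (i + 1))) +
        (1 - insertCoeff t m z (q + 1) (i + 1)) * ((x - insertKnot t m z (i + 1)) /
          (insertKnot t m z (i + q + 2) - insertKnot t m z (i + 1))) := by
  have e0 : i + 1 + q = i + q + 1 := by omega
  have e3 : i + 1 + (q + 1) = i + q + 2 := by omega
  have hab := ht (Nat.le_succ i)
  simp only [Nat.succ_eq_add_one] at hab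
  have hTT := ht (Nat.le_succ (i + q + 1))
  simp only [Nat.succ_eq_add_one, add_assoc, one_add_one_eq_two] at hTT
  simp only [← add_assoc] at hTT
  rcases lt_trichotomy i m with h | h | h
  · rw [insertKnot_of_le h] at hlt ⊢
    have ha := ht (show i + 1 ≤ m from h)
    rcases lt_trichotomy (i + q + 1) m with h' | h' | h'
    · rw [insertKnot_of_le (by omega), insertCoeff_of_le (by omega), insertCoeff_of_le (by omega),
        insertCoeff_of_le (by omega)]
      ring
    · rw [show i + q + 2 = m + 1 by omega, insertKnot_self] at hlt ⊢
      rw [insertCoeff_of_le (by omega), insertCoeff_of_le (by omega),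
        insertCoeff_of_mid h (by omega), show i + 1 + (q + 1) = m + 1 by omega]
      have e1 : t (m + 1) - t (i + 1) ≠ 0 := by linarith
      have e2 : z - t (i + 1) ≠ 0 := by linarith
      field_simp
      ring
    · rw [insertKnot_of_lt h'] at hlt ⊢
      rw [insertCoeff_of_mid h (by omega), insertCoeff_of_mid h.le (by omega),
        insertCoeff_of_mid h (by omega), e0, e3, ← add_assoc]
      have e1 : t (i + q + 1) - t (i + 1) ≠ 0 := by linarith
      have e2 : t (i + q + 1) - t i ≠ 0 := by linarith
      have e4 : t (i + q + 2) - t (i + 1) ≠ 0 := by linarith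
      field_simp
      ring
  · subst h
    rw [insertKnot_self, insertKnot_of_lt (show i < i + q + 1 by omega)] at hlt ⊢
    rw [insertCoeff_of_mid le_rfl (by omega), insertCoeff_of_lt (by omega),
      insertCoeff_of_lt (by omega), ← add_assoc]
    have e1 : t (i + q + 1) - t i ≠ 0 := by linarith
    have e2 : t (i + q + 1) - z ≠ 0 := by linarith
    field_simp
    ring
  · rw [insertKnot_of_lt h, insertKnot_of_lt (show m < i + q + 1 by omega),
      insertCoeff_of_lt (by omega), insertCoeff_of_lt h, insertCoeff_of_lt (by omega)]
    ring

/-- Boehm's knot insertion formula. -/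
theorem coxDeBoor_eq_insertKnot {t : ℕ → ℝ} (ht : Monotone t) {m : ℕ} {z : ℝ} (h1 : t m ≤ z)
    (h2 : z < t (m + 1)) (x : ℝ) (q : ℕ) : ∀ i, coxDeBoor t q i x =
      insertCoeff t m z q i * coxDeBoor (insertKnot t m z) q i x +
        (1 - insertCoeff t m z q (i + 1)) * coxDeBoor (insertKnot t m z) q (i + 1) x := by
  have ht' := insertKnot_monotone ht h1 h2
  induction q with
  | zero =>
    intro i
    rcases lt_trichotomy i m with h | h | h
    · rw [insertCoeff_of_le (by omega), insertCoeff_of_le (by omega), sub_self, zero_mul, add_zero,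
        one_mul]
      refine coxDeBoor_congr x 0 i fun k hk => (insertKnot_of_le (by omega)).symm
    -- The span containing `z` is split by it into two half-open spans, whose indicators add up.
    · subst h
      rw [insertCoeff_of_le (by omega), insertCoeff_of_lt (by omega)]
      simp only [coxDeBoor, insertKnot_self, insertKnot_of_le le_rfl,
        insertKnot_of_lt (Nat.lt_succ_self i), Nat.succ_eq_add_one]
      grind
    · rw [insertCoeff_of_lt h, insertCoeff_of_lt (by omega)]
      simp only [coxDeBoor, insertKnot_of_lt h, insertKnot_of_lt (Nat.lt_succ_of_lt h),
        Nat.succ_eq_add_one, zero_mul, zero_add, sub_zero, one_mul]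
  | succ q ih =>
    intro i
    set t' := insertKnot t m z with ht'def
    have e1 : i + 1 + q + 1 = i + q + 2 := by omega
    have e2 : i + 1 + q + 2 = i + q + 3 := by omega
    have e3 : i + 1 + 1 = i + 2 := by omega
    -- Both sides are expanded in the refined B-splines of degree `q` with indices `i`, `i + 1`, `i
    -- + 2`; `A`, `B`, `C` compare their terms.
    have A : ((x - t i) / (t (i + q + 1) - t i) * insertCoeff t m z q i) * coxDeBoor t' q i x =
        (insertCoeff t m z (q + 1) i * ((x - t' i) / (t' (i + q + 1) - t' i))) *
          coxDeBoor t' q i x := by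
      rcases lt_or_ge (t' i) (t' (i + q + 1)) with h | h
      · rw [insertCoeff_left ht h2 x h]
      · rw [coxDeBoor_eq_zero_of_knot_eq ht' h, mul_zero, mul_zero]
    have B : ((x - t i) / (t (i + q + 1) - t i) * (1 - insertCoeff t m z q (i + 1)) +
          (t (i + q + 2) - x) / (t (i + q + 2) - t (i + 1)) * insertCoeff t m z q (i + 1)) *
            coxDeBoor t' q (i + 1) x =
        (insertCoeff t m z (q + 1) i * ((t' (i + q + 2) - x) / (t' (i + q + 2) - t' (i + 1))) +
          (1 - insertCoeff t m z (q + 1) (i + 1)) *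
            ((x - t' (i + 1)) / (t' (i + q + 2) - t' (i + 1)))) * coxDeBoor t' q (i + 1) x := by
      rcases lt_or_ge (t' (i + 1)) (t' (i + q + 2)) with h | h
      · rw [insertCoeff_middle ht h1 h2 x h]
      · rw [coxDeBoor_eq_zero_of_knot_eq ht' (by rw [e1]; exact h), mul_zero, mul_zero]
    have C : ((t (i + q + 2) - x) / (t (i + q + 2) - t (i + 1)) *
          (1 - insertCoeff t m z q (i + 2))) * coxDeBoor t' q (i + 2) x =
        ((1 - insertCoeff t m z (q + 1) (i + 1)) *
          ((t' (i + q + 3) - x) / (t' (i + q + 3) - t' (i + 2)))) * coxDeBoor t' q (i + 2) x := by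
      rcases lt_or_ge (t' (i + 2)) (t' (i + q + 3)) with h | h
      · have := insertCoeff_right (i := i + 1) ht h1 h2 x (q := q)
          (by rw [e2]; exact h)
        rw [e1, e2, e3] at this
        rw [this]
      · rw [coxDeBoor_eq_zero_of_knot_eq ht' (by
          rw [show i + 2 + q + 1 = i + q + 3 by omega]; exact h), mul_zero, mul_zero]
    simp only [coxDeBoor]
    rw [ih i, ih (i + 1), e1, e2, e3]
    linear_combination A + B + C

end TensorSpline

end

/-! ### Nonnegativity of spline minors and the Schoenberg-Whitney theorem -/

noncomputable section

namespace TensorSpline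

/-- Pigeonhole: the indices up to `i` cannot be mapped injectively into those below `i`. -/
theorem exists_le_le_perm_apply {n : ℕ} (σ : Equiv.Perm (Fin n)) (i : Fin n) :
    ∃ k ≤ i, i ≤ σ k := by
  by_contra! h
  have := Finset.card_le_card_of_injOn (s := Finset.Iic i) (t := Finset.Iio i) σ
    (fun k hk => by simpa using h k (by simpa using hk)) σ.injective.injOn
  simp at this

theorem exists_ge_perm_apply_le {n : ℕ} (σ : Equiv.Perm (Fin n)) (i : Fin n) :
    ∃ k, i ≤ k ∧ σ k ≤ i := by
  obtain ⟨k, hk, hk'⟩ := exists_le_le_perm_apply σ⁻¹ i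
  exact ⟨σ⁻¹ k, hk', by simpa using hk⟩

/-- The left half at `i` follows from a `k ≤ i` with `i ≤ σ k`, the right half from an `l ≥ i` with
`σ l ≤ i`. -/
theorem inSupport_of_perm {t : ℕ → ℝ} (ht : Monotone t) {q n : ℕ} {x : Fin n → ℝ}
    (hx : Monotone x) {J : Fin n → ℕ} (hJ : Monotone J) (σ : Equiv.Perm (Fin n))
    (h : ∀ i, InSupport t q (J (σ i)) (x i)) (i : Fin n) : InSupport t q (J i) (x i) := by
  obtain ⟨k, hk, hk'⟩ := exists_le_le_perm_apply σ i
  obtain ⟨l, hl, hl'⟩ := exists_ge_perm_apply_le σ i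
  exact ⟨(h k).1.mono ht (hJ hk') (hx hk), (h l).2.mono ht (hJ hl') (hx hl)⟩

theorem exists_perm_of_det_ne_zero {ι R : Type*} [Fintype ι] [DecidableEq ι] [CommRing R]
    {A : Matrix ι ι R} (h : A.det ≠ 0) : ∃ σ : Equiv.Perm ι, ∀ i, A (σ i) i ≠ 0 := by
  rw [Matrix.det_apply] at h
  obtain ⟨σ, -, hσ⟩ := Finset.exists_ne_zero_of_sum_ne_zero h
  refine ⟨σ, fun i hi => hσ ?_⟩
  have h0 : ∏ i, A (σ i) i = 0 := Finset.prod_eq_zero (Finset.mem_univ i) hi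
  rw [h0, smul_zero]

/-- The transposed collocation matrix of the B-splines with indices `J` at the points `x`. -/
def splineMatrix {n : ℕ} (t : ℕ → ℝ) (q : ℕ) (J : Fin n → ℕ) (x : Fin n → ℝ) :
    Matrix (Fin n) (Fin n) ℝ :=
  Matrix.of fun l i => coxDeBoor t q (J l) (x i)

theorem pos_of_splineMatrix_det_ne_zero {t : ℕ → ℝ} (ht : Monotone t) {q n : ℕ} {x : Fin n → ℝ}
    (hx : Monotone x) {J : Fin n → ℕ} (hJ : Monotone J) (h : (splineMatrix t q J x).det ≠ 0)
    (i : Fin n) : 0 < coxDeBoor t q (J i) (x i) := by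
  obtain ⟨σ, hσ⟩ := exists_perm_of_det_ne_zero h
  exact (coxDeBoor_pos_iff ht).2
    (inSupport_of_perm ht hx hJ σ (fun i => (coxDeBoor_ne_zero_iff ht).1 (hσ i)) i)

/-- The weights with which the two refined B-splines enter a B-spline upon knot insertion. -/
def insertWeight (t : ℕ → ℝ) (m : ℕ) (z : ℝ) (q j : ℕ) (e : Fin 2) : ℝ :=
  if e = 0 then insertCoeff t m z q j else 1 - insertCoeff t m z q (j + 1)

theorem insertWeight_nonneg {t : ℕ → ℝ} (ht : Monotone t) {m : ℕ} {z : ℝ} (h1 : t m ≤ z)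
    (h2 : z < t (m + 1)) (q j : ℕ) (e : Fin 2) : 0 ≤ insertWeight t m z q j e := by
  rw [insertWeight]
  split_ifs
  · exact insertCoeff_nonneg ht h1 q j
  · exact sub_nonneg.2 (insertCoeff_le_one ht h1 h2 q _)

theorem coxDeBoor_eq_sum_insertKnot {t : ℕ → ℝ} (ht : Monotone t) {m : ℕ} {z : ℝ} (h1 : t m ≤ z)
    (h2 : z < t (m + 1)) (x : ℝ) (q j : ℕ) : coxDeBoor t q j x =
      ∑ e : Fin 2, insertWeight t m z q j e * coxDeBoor (insertKnot t m z) q (j + e) x := by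
  rw [coxDeBoor_eq_insertKnot ht h1 h2]
  simp [Fin.sum_univ_two, insertWeight]

/-- Multilinearity of the determinant in its rows, each of which belongs to one B-spline and splits
in two. -/
theorem splineMatrix_det_eq_sum {t : ℕ → ℝ} (ht : Monotone t) {m : ℕ} {z : ℝ} (h1 : t m ≤ z)
    (h2 : z < t (m + 1)) {q n : ℕ} (x : Fin n → ℝ) (J : Fin n → ℕ) :
    (splineMatrix t q J x).det = ∑ ε : Fin n → Fin 2,
      (∏ l, insertWeight t m z q (J l) (ε l)) *
        (splineMatrix (insertKnot t m z) q (fun l => J l + ε l) x).det := by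
  have hrow : splineMatrix t q J x = fun l => ∑ e : Fin 2, insertWeight t m z q (J l) e •
      fun i => coxDeBoor (insertKnot t m z) q (J l + e) (x i) := by
    funext l i
    simp only [splineMatrix, Matrix.of_apply, Finset.sum_apply, Pi.smul_apply, smul_eq_mul]
    exact coxDeBoor_eq_sum_insertKnot ht h1 h2 (x i) q (J l)
  have := (Matrix.detRowAlternating (n := Fin n) (R := ℝ)).toMultilinearMap.map_sum
    (fun l (e : Fin 2) => insertWeight t m z q (J l) e •
      fun i => coxDeBoor (insertKnot t m z) q (J l + e) (x i))
  rw [hrow]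
  refine this.trans (Finset.sum_congr rfl fun ε _ => ?_)
  exact MultilinearMap.map_smul_univ _ _ _

/-- To the left of the inserted knot, the first refined B-spline is positive where the given
B-spline is. -/
theorem insertKnot_pos_left {t : ℕ → ℝ} (ht : Monotone t) {m : ℕ} {z : ℝ} (h1 : t m ≤ z)
    (h2 : z < t (m + 1)) {q j : ℕ} {x : ℝ} (hx : x < z) (h : 0 < coxDeBoor t q j x) :
    0 < insertWeight t m z q j 0 * coxDeBoor (insertKnot t m z) q (j + (0 : Fin 2)) x := by
  have ht' := insertKnot_monotone ht h1 h2
  obtain ⟨⟨ha, hb⟩, hc, hd⟩ := (coxDeBoor_pos_iff ht).1 h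
  have hj : t j < z := ha.le.trans_lt hx
  have hle : ∀ {k}, t k < z → k ≤ m := fun {k} hk => by
    by_contra hcon
    have := ht (show m + 1 ≤ k by omega)
    linarith
  have hright : ∀ {k}, m < k → x < insertKnot t m z k := fun {k} hk => by
    have := ht' (show m + 1 ≤ k from hk)
    rw [insertKnot_self] at this
    linarith
  refine mul_pos ?_ ((coxDeBoor_pos_iff ht').2 ?_)
  · rw [insertWeight, if_pos rfl]
    exact insertCoeff_pos ht h2 hj
  · simp only [Fin.val_zero, add_zero]
    refine ⟨⟨?_, ?_⟩, ?_, ?_⟩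
    · rwa [insertKnot_of_le (hle hj)]
    · rw [insertKnot_of_le (hle hj)]
      refine hb.imp id fun hb => ?_
      rwa [insertKnot_of_le (hle (hb.le.trans_lt hx))]
    · rcases le_or_gt (j + q + 1) m with hk | hk
      · rwa [insertKnot_of_le hk]
      · exact not_below_of_lt (hright hk)
    · rcases le_or_gt (j + q + 1) m with hk | hk
      · rwa [insertKnot_of_le hk, insertKnot_of_le (by omega)]
      · exact Or.inl (hright hk)

/-- To the right of the inserted knot, the second refined B-spline is positive where the given
B-spline is. -/
theorem insertKnot_pos_right {t : ℕ → ℝ} (ht : Monotone t) {m : ℕ} {z : ℝ} (h1 : t m ≤ z)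
    (h2 : z < t (m + 1)) {q j : ℕ} {x : ℝ} (hx : z < x) (h : 0 < coxDeBoor t q j x) :
    0 < insertWeight t m z q j 1 * coxDeBoor (insertKnot t m z) q (j + (1 : Fin 2)) x := by
  have ht' := insertKnot_monotone ht h1 h2
  obtain ⟨⟨ha, hb⟩, hc, hd⟩ := (coxDeBoor_pos_iff ht).1 h
  have hj : z < t (j + q + 1) := hx.trans_le (le_of_not_below hc)
  have hgt : ∀ {k}, z < t k → m < k := fun {k} hk => by
    by_contra hcon
    have := ht (show k ≤ m by omega)
    linarith
  have hleft : ∀ {k}, k ≤ m + 1 → insertKnot t m z k < x := fun {k} hk => by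
    have := ht' hk
    rw [insertKnot_self] at this
    linarith
  refine mul_pos ?_ ((coxDeBoor_pos_iff ht').2 ?_)
  · rw [insertWeight, if_neg (by decide)]
    exact sub_pos.2 (insertCoeff_lt_one ht h1 (by rwa [show j + 1 + q = j + q + 1 by omega]))
  · simp only [Fin.val_one]
    have e1 : j + 1 + q = j + q + 1 := by omega
    have hend : insertKnot t m z (j + q + 1 + 1) = t (j + q + 1) := insertKnot_of_lt (hgt hj)
    refine ⟨⟨?_, ?_⟩, ?_, ?_⟩
    · rcases lt_or_ge m j with hk | hk
      · rwa [insertKnot_of_lt hk]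
      · exact below_of_lt (hleft (by omega))
    · rcases lt_or_ge m j with hk | hk
      · rwa [insertKnot_of_lt hk, e1, insertKnot_of_lt (by omega)]
      · exact Or.inl (hleft (by omega))
    · rwa [e1, hend]
    · rw [e1, hend]
      refine hd.imp id fun hd => ?_
      rwa [insertKnot_of_lt (hgt (hx.trans_le (le_of_not_below hd)))]

/-- At a point of full multiplicity, only one B-spline does not vanish. -/
theorem inSupport_unique {t : ℕ → ℝ} (ht : Monotone t) {q k : ℕ} {x : ℝ}
    (hk : ∀ l, l < q + 1 → t (k + l) = x) {i j : ℕ} (hi : InSupport t q i x)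
    (hj : InSupport t q j x) : i = j := by
  have h0 : t k = x := hk 0 (by omega)
  have h1 : t (k + q) = x := hk q (by omega)
  -- The coinciding knots are the first `q + 1` of the B-spline if `x ≠ 1`, and the last `q + 1` at
  -- `1`, where left limits are taken.
  have main : ∀ {i}, InSupport t q i x → (x ≠ 1 → t i = x ∧ t (i + q) = x ∧ x < t (i + q + 1)) ∧
      (x = 1 → t i < x ∧ t (i + 1) = x ∧ t (i + q + 1) = x) := by
    rintro i ⟨⟨ha, hb⟩, hc, hd⟩
    constructor
    · intro hx
      have hB : ∀ {τ}, Below x τ ↔ τ ≤ x := fun {τ} =>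
        ⟨Below.le, fun h => h.lt_or_eq.imp id fun h => ⟨h, hx⟩⟩
      rw [hB] at ha hc
      have hki : k ≤ i := by
        by_contra hcon
        have := ht (show i + q + 1 ≤ k + q by omega)
        linarith
      have hxi : t i = x := le_antisymm ha (h0 ▸ ht hki)
      rw [hB] at hb
      have := hb.resolve_left (by rw [hxi]; exact lt_irrefl x)
      exact ⟨hxi, le_antisymm this (hxi ▸ ht (Nat.le_add_right i q)), not_le.1 hc⟩
    · intro hx
      have hB : ∀ {τ}, Below x τ ↔ τ < x := fun {τ} =>
        ⟨fun h => h.resolve_right fun h => h.2 hx, Or.inl⟩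
      rw [hB] at ha hc
      have hki : i + 1 ≤ k := by
        by_contra hcon
        have := ht (show k ≤ i by omega)
        linarith
      have hxi : t (i + q + 1) = x := le_antisymm (h1 ▸ ht (by omega)) (not_lt.1 hc)
      rw [hB] at hd
      have := hd.resolve_left (by rw [hxi]; exact lt_irrefl x)
      exact ⟨ha, le_antisymm (hxi ▸ ht (by omega)) (not_lt.1 this), hxi⟩
  have le : ∀ {i j}, InSupport t q i x → InSupport t q j x → i ≤ j := by
    intro i j hi hj
    by_contra! hij
    by_cases hx : x = 1
    · have := (main hi).2 hx
      have := (main hj).2 hx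
      have := ht (show j + 1 ≤ i from hij)
      linarith
    · have := (main hi).1 hx
      have := (main hj).1 hx
      have := ht (show j + q + 1 ≤ i + q by omega)
      linarith
  exact le_antisymm (le hi hj) (le hj hi)

theorem exists_knot_le_lt {t : ℕ → ℝ} {z : ℝ} (h0 : t 0 ≤ z) (h : ∃ k, z < t k) :
    ∃ m, t m ≤ z ∧ z < t (m + 1) := by
  classical
  have hspec := Nat.find_spec h
  have hmin := fun k => Nat.find_min h (m := k)
  rcases hk : Nat.find h with _ | m
  · rw [hk] at hspec
    exact absurd hspec (not_lt.2 h0)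
  · rw [hk] at hspec hmin
    exact ⟨m, not_lt.1 (hmin m (Nat.lt_succ_self m)), hspec⟩

/-- A run of equal knots survives knot insertion. -/
theorem exists_insertKnot_run {t : ℕ → ℝ} (ht : Monotone t) {m : ℕ} {z : ℝ} (h1 : t m ≤ z)
    (h2 : z < t (m + 1)) {r : ℕ} {y : ℝ} (hy : ∃ k, ∀ l, l < r → t (k + l) = y) :
    ∃ k, ∀ l, l < r → insertKnot t m z (k + l) = y := by
  obtain ⟨k, hk⟩ := hy
  rcases le_or_gt y z with hyz | hyz
  · refine ⟨k, fun l hl => ?_⟩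
    rw [insertKnot_of_le, hk l hl]
    by_contra hcon
    have := ht (show m + 1 ≤ k + l by omega)
    rw [hk l hl] at this
    linarith
  · refine ⟨k + 1, fun l hl => ?_⟩
    rw [add_right_comm, insertKnot_of_lt, hk l hl]
    by_contra hcon
    have := ht (show k + l ≤ m by omega)
    rw [hk l hl] at this
    linarith

/-- A run of knots at the inserted knot gets longer. -/
theorem exists_insertKnot_run_succ {t : ℕ → ℝ} (ht : Monotone t) {m : ℕ} {z : ℝ} (h1 : t m ≤ z)
    (h2 : z < t (m + 1)) {r : ℕ} (hz : ∃ k, ∀ l, l < r → t (k + l) = z) :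
    ∃ k, ∀ l, l < r + 1 → insertKnot t m z (k + l) = z := by
  obtain ⟨k, hk⟩ := hz
  have hle : ∀ l, l < r → k + l ≤ m := fun l hl => by
    by_contra hcon
    have := ht (show m + 1 ≤ k + l by omega)
    rw [hk l hl] at this
    linarith
  rcases Nat.eq_zero_or_pos r with rfl | hr
  · refine ⟨m + 1, fun l hl => ?_⟩
    rw [show l = 0 by omega, add_zero, insertKnot_self]
  · refine ⟨k, fun l hl => ?_⟩
    have hr' := hle (r - 1) (by omega)
    rcases (show k + l ≤ m + 1 by omega).eq_or_lt with h | h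
    · rw [h, insertKnot_self]
    · rw [insertKnot_of_le (by omega)]
      refine le_antisymm ((ht (by omega)).trans h1) ?_
      rw [← hk 0 hr]
      exact ht (by omega)

/-- The induction step over one inserted knot: all terms of the expansion are nonnegative, and a
positive diagonal selects a positive one. -/
theorem splineMatrix_det_pos_of_refined {t : ℕ → ℝ} (ht : Monotone t) {m : ℕ} {z : ℝ}
    (h1 : t m ≤ z) (h2 : z < t (m + 1)) {q n : ℕ} {x : Fin n → ℝ} (hx : StrictMono x)
    (H : ∀ J : Fin n → ℕ, StrictMono J → 0 ≤ (splineMatrix (insertKnot t m z) q J x).det ∧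
      ((∀ i, 0 < coxDeBoor (insertKnot t m z) q (J i) (x i)) →
        0 < (splineMatrix (insertKnot t m z) q J x).det))
    {J : Fin n → ℕ} (hJ : StrictMono J) : 0 ≤ (splineMatrix t q J x).det ∧
      ((∀ i, 0 < coxDeBoor t q (J i) (x i)) → 0 < (splineMatrix t q J x).det) := by
  have ht' := insertKnot_monotone ht h1 h2
  have hterm : ∀ ε : Fin n → Fin 2, 0 ≤ (∏ l, insertWeight t m z q (J l) (ε l)) *
      (splineMatrix (insertKnot t m z) q (fun l => J l + ε l) x).det := by
    intro ε
    refine mul_nonneg (Finset.prod_nonneg fun l _ => insertWeight_nonneg ht h1 h2 _ _ _) ?_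
    -- Shifts by at most one keep `J` nondecreasing, so the indices are strictly increasing unless
    -- two rows coincide.
    by_cases hinj : Function.Injective fun l => J l + (ε l : ℕ)
    · refine (H _ (Monotone.strictMono_of_injective (fun a b hab => ?_) hinj)).1
      rcases hab.eq_or_lt with rfl | hab
      · exact le_rfl
      · have := hJ hab
        have := (ε a).isLt
        omega
    · simp only [Function.Injective, not_forall] at hinj
      obtain ⟨a, b, hab, hne⟩ := hinj
      refine (Matrix.det_zero_of_row_eq hne ?_).ge
      funext i
      simp only [splineMatrix, Matrix.of_apply]
      rw [hab]
  rw [splineMatrix_det_eq_sum ht h1 h2]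
  refine ⟨Finset.sum_nonneg fun ε _ => hterm ε, fun hpos => ?_⟩
  have hchoice : ∀ i, ∃ e : Fin 2, (x i < z → e = 0) ∧ (z < x i → e = 1) ∧
      0 < insertWeight t m z q (J i) e * coxDeBoor (insertKnot t m z) q (J i + e) (x i) := by
    intro i
    rcases lt_trichotomy (x i) z with h | h | h
    · exact ⟨0, fun _ => rfl, fun h' => absurd h' h.not_gt,
        insertKnot_pos_left ht h1 h2 h (hpos i)⟩
    · have := hpos i
      rw [coxDeBoor_eq_sum_insertKnot ht h1 h2] at this
      obtain ⟨e, -, he⟩ := Finset.exists_lt_of_sum_lt (s := Finset.univ)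
        (f := fun _ : Fin 2 => (0 : ℝ)) (g := fun e => insertWeight t m z q (J i) e *
          coxDeBoor (insertKnot t m z) q (J i + e) (x i)) (by rwa [Finset.sum_const_zero])
      exact ⟨e, fun h' => absurd h h'.ne, fun h' => absurd h h'.ne', he⟩
    · exact ⟨1, fun h' => absurd h' h.not_gt, fun _ => rfl,
        insertKnot_pos_right ht h1 h2 h (hpos i)⟩
  choose ε hε0 hε1 hε using hchoice
  have hw : ∀ i, 0 < insertWeight t m z q (J i) (ε i) := fun i =>
    pos_of_mul_pos_left (hε i) (coxDeBoor_nonneg ht' _ _ _)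
  have hb : ∀ i, 0 < coxDeBoor (insertKnot t m z) q (J i + ε i) (x i) := fun i =>
    pos_of_mul_pos_right (hε i) (hw i).le
  -- The choice is `0` left of `z` and `1` right of it, and at most one point equals `z`, so `ε` is
  -- nondecreasing.
  have hJε : StrictMono fun l => J l + (ε l : ℕ) := by
    intro a b hab
    have hJab := hJ hab
    have hxab := hx hab
    have : ε a ≤ ε b := by
      rcases lt_or_ge (x a) z with h | h
      · rw [hε0 a h]
        exact Fin.zero_le _
      · rw [hε1 b (h.trans_lt hxab)]
        exact Fin.le_last _
    exact add_lt_add_of_lt_of_le hJab this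
  exact Finset.sum_pos' (fun ε _ => hterm ε) ⟨ε, Finset.mem_univ ε,
    mul_pos (Finset.prod_pos fun l _ => hw l) ((H _ hJε).2 hb)⟩

/-- Only one B-spline is nonzero at each point, so a positive diagonal makes the matrix diagonal; a
nonzero determinant forces a positive diagonal. -/
theorem splineMatrix_det_of_full_multiplicity {t : ℕ → ℝ} (ht : Monotone t) {q n : ℕ}
    {x : Fin n → ℝ} (hx : StrictMono x) (hk : ∀ i, ∃ k, ∀ l, l < q + 1 → t (k + l) = x i)
    {J : Fin n → ℕ} (hJ : StrictMono J) : 0 ≤ (splineMatrix t q J x).det ∧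
      ((∀ i, 0 < coxDeBoor t q (J i) (x i)) → 0 < (splineMatrix t q J x).det) := by
  have hpos : (∀ i, 0 < coxDeBoor t q (J i) (x i)) → 0 < (splineMatrix t q J x).det := by
    intro hpos
    have : splineMatrix t q J x = Matrix.diagonal fun i => coxDeBoor t q (J i) (x i) := by
      ext l i
      rcases eq_or_ne l i with rfl | hne
      · rw [Matrix.diagonal_apply_eq, splineMatrix, Matrix.of_apply]
      · rw [Matrix.diagonal_apply_ne _ hne, splineMatrix, Matrix.of_apply]
        by_contra h0
        obtain ⟨k, hk⟩ := hk i
        exact hne (hJ.injective (inSupport_unique ht hk ((coxDeBoor_ne_zero_iff ht).1 h0)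
          ((coxDeBoor_pos_iff ht).1 (hpos i))))
    rw [this, Matrix.det_diagonal]
    exact Finset.prod_pos fun i _ => hpos i
  refine ⟨?_, hpos⟩
  by_cases h0 : (splineMatrix t q J x).det = 0
  · exact h0.ge
  · exact (hpos (pos_of_splineMatrix_det_ne_zero ht hx.monotone hJ.monotone h0)).le

/-- `L` lists the knots still to be inserted; the copies of `x i` in it make up for those missing
from `t`. -/
theorem splineMatrix_det_of_list {q n : ℕ} {x : Fin n → ℝ} (hx : StrictMono x) (L : List ℝ) :
    ∀ t : ℕ → ℝ, Monotone t → (∀ z ∈ L, t 0 ≤ z) → (∀ z, ∃ k, z < t k) →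
      (∀ i, ∃ k, ∀ l, l < q + 1 - L.count (x i) → t (k + l) = x i) →
      ∀ J : Fin n → ℕ, StrictMono J → 0 ≤ (splineMatrix t q J x).det ∧
        ((∀ i, 0 < coxDeBoor t q (J i) (x i)) → 0 < (splineMatrix t q J x).det) := by
  induction L with
  | nil =>
    intro t ht _ _ hk J hJ
    exact splineMatrix_det_of_full_multiplicity ht hx (by simpa using hk) hJ
  | cons z L ih =>
    intro t ht hlow htop hk J hJ
    obtain ⟨m, h1, h2⟩ := exists_knot_le_lt (hlow z List.mem_cons_self) (htop z)
    refine splineMatrix_det_pos_of_refined ht h1 h2 hx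
      (ih _ (insertKnot_monotone ht h1 h2) ?_ ?_ ?_) hJ
    · intro y hy
      rw [insertKnot_of_le (Nat.zero_le m)]
      exact hlow y (List.mem_cons_of_mem z hy)
    · intro y
      obtain ⟨k, hk⟩ := htop y
      refine ⟨m + 1 + k + 1, ?_⟩
      rw [insertKnot_of_lt (by omega)]
      exact hk.trans_le (ht (by omega))
    · intro i
      rcases eq_or_ne z (x i) with h | h
      · have hki := hk i
        rw [← h, List.count_cons_self] at hki
        rw [← h]
        obtain ⟨k, hk'⟩ := exists_insertKnot_run_succ ht h1 h2 hki
        exact ⟨k, fun l hl => hk' l (by omega)⟩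
      · have hki := hk i
        rw [List.count_cons_of_ne h] at hki
        exact exists_insertKnot_run ht h1 h2 hki

/-- The Schoenberg-Whitney theorem, for knots which tend to infinity. -/
theorem splineMatrix_det_pos {t : ℕ → ℝ} (ht : Monotone t) (htop : ∀ z, ∃ k, z < t k) {q n : ℕ}
    {x : Fin n → ℝ} (hx : StrictMono x) (hlow : ∀ i, t 0 ≤ x i) {J : Fin n → ℕ}
    (hJ : StrictMono J) (hpos : ∀ i, 0 < coxDeBoor t q (J i) (x i)) :
    0 < (splineMatrix t q J x).det := by
  -- Every point is listed `q + 1` times, so no copy need be present in `t` and the start `0` of the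
  -- empty run is arbitrary.
  refine (splineMatrix_det_of_list hx ((List.ofFn x).flatMap (List.replicate (q + 1))) t ht ?_ htop
    (fun i => ⟨0, fun l hl => ?_⟩) J hJ).2 hpos
  · intro z hz
    simp only [List.mem_flatMap, List.mem_ofFn, List.mem_replicate] at hz
    obtain ⟨y, ⟨i, rfl⟩, -, rfl⟩ := hz
    exact hlow i
  · have : q + 1 ≤ List.count (x i) ((List.ofFn x).flatMap (List.replicate (q + 1))) := by
      have hsub : (List.replicate (q + 1) (x i)).Sublist
          ((List.ofFn x).flatMap (List.replicate (q + 1))) := by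
        rw [List.flatMap_def]
        exact List.sublist_flatten_of_mem (List.mem_map.2 ⟨x i, by simp, rfl⟩)
      simpa using hsub.count_le (x i)
    omega

end TensorSpline

end

noncomputable section

namespace TensorSpline

/-! ### Univariate interpolation -/

/-- The knots as a sequence which tends to infinity; the values beyond the last knot never enter
the B-splines of the spline space. -/
def KnotVector.extend {p n : ℕ} (Ξ : KnotVector p n) (m : ℕ) : ℝ :=
  Ξ.seq m + (m - (n + p) : ℕ)

theorem KnotVector.extend_monotone {p n : ℕ} (Ξ : KnotVector p n) : Monotone Ξ.extend := by
  intro a b hab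
  refine add_le_add (Ξ.monotone_knot ?_) (Nat.cast_le.2 (by omega))
  rw [Fin.mk_le_mk]
  omega

/-- Inserting a knot requires a strictly larger one, which a clamped knot vector lacks for the point
`1`. -/
theorem KnotVector.exists_lt_extend {p n : ℕ} (Ξ : KnotVector p n) (z : ℝ) :
    ∃ k, z < Ξ.extend k := by
  obtain ⟨N, hN⟩ := exists_nat_gt (z - Ξ.seq (n + p))
  refine ⟨n + p + N, ?_⟩
  have : Ξ.seq (n + p + N) = Ξ.seq (n + p) := by
    simp only [KnotVector.seq, min_self, min_eq_right (Nat.le_add_right (n + p) N)]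
  rw [KnotVector.extend, this, Nat.add_sub_cancel_left]
  linarith

theorem KnotVector.extend_zero_le {p n : ℕ} (Ξ : KnotVector p n) : Ξ.extend 0 ≤ 0 := by
  rw [KnotVector.extend, Nat.zero_sub, Nat.cast_zero, add_zero, ← Ξ.knot_left]
  refine Ξ.monotone_knot ?_
  rw [Fin.mk_le_mk]
  omega

theorem KnotVector.bspline_eq {p n : ℕ} (Ξ : KnotVector p n) (j : Fin n) (x : ℝ) :
    Ξ.bspline j x = coxDeBoor Ξ.extend p j x := by
  refine coxDeBoor_congr x p j fun k hk => ?_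
  have := j.isLt
  rw [KnotVector.extend, Nat.sub_eq_zero_of_le (by omega), Nat.cast_zero, add_zero]

theorem KnotVector.bspline_nonneg {p n : ℕ} (Ξ : KnotVector p n) (j : Fin n) (x : ℝ) :
    0 ≤ Ξ.bspline j x := by
  rw [Ξ.bspline_eq]
  exact coxDeBoor_nonneg Ξ.extend_monotone p j x

/-- Sorting the points only permutes rows, and `inSupport_of_perm` keeps the diagonal positive. -/
theorem KnotVector.isUnit_collocationMatrix {p n : ℕ} (Ξ : KnotVector p n) {ξ : Fin n → ℝ}
    (hinj : Function.Injective ξ) (hξ : ∀ j, 0 ≤ ξ j) (hpos : ∀ j, 0 < Ξ.bspline j (ξ j)) :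
    IsUnit (collocationMatrix Ξ.bspline ξ) := by
  set τ := Tuple.sort ξ
  have hmono : Monotone (ξ ∘ τ) := Tuple.monotone_sort ξ
  have hval : StrictMono fun j : Fin n => (j : ℕ) := Fin.val_strictMono
  have hdet : 0 < (splineMatrix Ξ.extend p (fun j : Fin n => (j : ℕ)) (ξ ∘ τ)).det := by
    refine splineMatrix_det_pos Ξ.extend_monotone Ξ.exists_lt_extend
      (hmono.strictMono_of_injective (hinj.comp τ.injective))
      (fun i => Ξ.extend_zero_le.trans (hξ _)) hval fun i => ?_
    refine (coxDeBoor_pos_iff Ξ.extend_monotone).2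
      (inSupport_of_perm Ξ.extend_monotone hmono hval.monotone τ (fun i => ?_) i)
    rw [← coxDeBoor_pos_iff Ξ.extend_monotone, ← Ξ.bspline_eq]
    exact hpos (τ i)
  have heq : splineMatrix Ξ.extend p (fun j : Fin n => (j : ℕ)) (ξ ∘ τ) =
      ((collocationMatrix Ξ.bspline ξ).submatrix τ (Equiv.refl _)).transpose := by
    ext j i
    simp [splineMatrix, collocationMatrix, Ξ.bspline_eq]
  rw [heq] at hdet
  have := (Matrix.isUnit_iff_isUnit_det _).2 hdet.ne'.isUnit
  rwa [Matrix.isUnit_transpose, Matrix.isUnit_submatrix_equiv] at this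

theorem KnotVector.bspline_pos_of_isUnit {p n : ℕ} (Ξ : KnotVector p n) {ξ : Fin n → ℝ}
    (hmono : Monotone ξ) (h : IsUnit (collocationMatrix Ξ.bspline ξ)) (j : Fin n) :
    0 < Ξ.bspline j (ξ j) := by
  have heq : splineMatrix Ξ.extend p (fun j : Fin n => (j : ℕ)) ξ =
      (collocationMatrix Ξ.bspline ξ).transpose := by
    ext j i
    simp [splineMatrix, collocationMatrix, Ξ.bspline_eq]
  rw [Ξ.bspline_eq]
  refine pos_of_splineMatrix_det_ne_zero Ξ.extend_monotone hmono
    (Fin.val_strictMono (n := n)).monotone ?_ j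
  rw [heq, Matrix.det_transpose]
  exact ((Matrix.isUnit_iff_isUnit_det _).1 h).ne_zero

theorem KnotVector.dim_pos {p n : ℕ} (Ξ : KnotVector p n) : 0 < n := by
  by_contra h
  have : Ξ.knot ⟨n, by omega⟩ ≤ Ξ.knot ⟨p, by omega⟩ :=
    Ξ.monotone_knot (by rw [Fin.mk_le_mk]; omega)
  rw [Ξ.knot_left, Ξ.knot_right] at this
  linarith

/-! ### Tensor products of matrices -/

/-- The tensor product (Kronecker product) of a finite family of matrices. -/
def tensorMatrix {κ R : Type*} [Fintype κ] [CommRing R] {ι : κ → Type*}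
    (A : ∀ k, Matrix (ι k) (ι k) R) : Matrix (∀ k, ι k) (∀ k, ι k) R :=
  Matrix.of fun i j => ∏ k, A k (i k) (j k)

theorem tensorMatrix_mul {κ R : Type*} [Fintype κ] [DecidableEq κ] [CommRing R] {ι : κ → Type*}
    [∀ k, Fintype (ι k)] (A B : ∀ k, Matrix (ι k) (ι k) R) :
    tensorMatrix A * tensorMatrix B = tensorMatrix fun k => A k * B k := by
  ext i j
  simp only [tensorMatrix, Matrix.mul_apply, Matrix.of_apply, Finset.prod_univ_sum,
    Fintype.piFinset_univ, Finset.prod_mul_distrib]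

theorem tensorMatrix_one {κ R : Type*} [Fintype κ] [CommRing R] {ι : κ → Type*}
    [∀ k, DecidableEq (ι k)] :
    tensorMatrix (fun k => (1 : Matrix (ι k) (ι k) R)) = 1 := by
  ext i j
  classical
  simp only [tensorMatrix, Matrix.of_apply, Matrix.one_apply, Finset.prod_ite_zero,
    Finset.prod_const_one, Finset.mem_univ, true_imp_iff, funext_iff]

theorem isUnit_tensorMatrix {κ R : Type*} [Fintype κ] [DecidableEq κ] [CommRing R]
    {ι : κ → Type*} [∀ k, Fintype (ι k)] [∀ k, DecidableEq (ι k)] {A : ∀ k, Matrix (ι k) (ι k) R}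
    (h : ∀ k, IsUnit (A k)) : IsUnit (tensorMatrix A) := by
  choose B hB hB' using fun k => isUnit_iff_exists.1 (h k)
  refine isUnit_iff_exists.2 ⟨tensorMatrix B, ?_, ?_⟩
  · rw [tensorMatrix_mul, funext hB, tensorMatrix_one]
  · rw [tensorMatrix_mul, funext hB', tensorMatrix_one]

/-- A kernel vector of one factor, tensored with all-ones vectors in the other directions, is a
nonzero kernel vector of the product. -/
theorem isUnit_of_isUnit_tensorMatrix {κ R : Type*} [Fintype κ] [DecidableEq κ] [Field R]
    {ι : κ → Type*} [∀ k, Fintype (ι k)] [∀ k, DecidableEq (ι k)] [∀ k, Nonempty (ι k)]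
    {A : ∀ k, Matrix (ι k) (ι k) R} (h : IsUnit (tensorMatrix A)) (k : κ) : IsUnit (A k) := by
  rw [Matrix.isUnit_iff_isUnit_det, isUnit_iff_ne_zero]
  intro hdet
  obtain ⟨v, hv, hAv⟩ := Matrix.exists_mulVec_eq_zero_iff.2 hdet
  obtain ⟨a, ha⟩ := Function.ne_iff.1 hv
  let w : ∀ l, ι l → R := Function.update (fun _ _ => 1) k v
  have hwk : w k = v := by simp only [w, Function.update_self]
  have hw : ∀ l, ∃ b, w l b ≠ 0 := by
    intro l
    rcases eq_or_ne l k with rfl | hl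
    · exact ⟨a, by rw [hwk]; exact ha⟩
    · exact ⟨Classical.arbitrary _, by simp only [w, Function.update_of_ne hl]; exact one_ne_zero⟩
  choose b hb using hw
  rw [Matrix.isUnit_iff_isUnit_det, isUnit_iff_ne_zero] at h
  refine h (Matrix.exists_mulVec_eq_zero_iff.1 ⟨fun j => ∏ l, w l (j l), ?_, ?_⟩)
  · exact Function.ne_iff.2 ⟨b, Finset.prod_ne_zero_iff.2 fun l _ => hb l⟩
  · funext i
    have : (tensorMatrix A).mulVec (fun j => ∏ l, w l (j l)) i =
        ∏ l, (A l).mulVec (w l) (i l) := by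
      simp only [tensorMatrix, Matrix.mulVec, dotProduct, Matrix.of_apply, Finset.prod_univ_sum,
        Fintype.piFinset_univ, Finset.prod_mul_distrib]
    rw [this]
    refine Finset.prod_eq_zero (Finset.mem_univ k) ?_
    rw [hwk, hAv, Pi.zero_apply]

/-! ### Tensor-product interpolation -/

variable {d : ℕ} {p n : Fin d → ℕ}

theorem physBasis_interpPoint (Ξ : ∀ k, KnotVector (p k) (n k))
    {F : (Fin d → ℝ) → (Fin d → ℝ)} (hF : Set.InjOn F (Set.Icc 0 1)) {ξ : ∀ k, Fin (n k) → ℝ}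
    (hξ : ∀ k j, ξ k j ∈ Set.Icc (0 : ℝ) 1) (i j : ∀ k, Fin (n k)) :
    physBasis Ξ F j (interpPoint F ξ i) = ∏ k, (Ξ k).bspline (j k) (ξ k (i k)) := by
  have hmem : (fun k => ξ k (i k)) ∈ Set.Icc (0 : Fin d → ℝ) 1 :=
    ⟨fun k => (hξ k (i k)).1, fun k => (hξ k (i k)).2⟩
  have := hF.leftInvOn_invFunOn hmem
  rw [physBasis, interpPoint, this, paramBasis]

theorem collocationMatrix_eq_tensorMatrix (Ξ : ∀ k, KnotVector (p k) (n k))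
    {F : (Fin d → ℝ) → (Fin d → ℝ)} (hF : Set.InjOn F (Set.Icc 0 1)) {ξ : ∀ k, Fin (n k) → ℝ}
    (hξ : ∀ k j, ξ k j ∈ Set.Icc (0 : ℝ) 1) :
    collocationMatrix (physBasis Ξ F) (interpPoint F ξ) =
      tensorMatrix fun k => collocationMatrix (Ξ k).bspline (ξ k) := by
  ext i j
  simp only [tensorMatrix, collocationMatrix, Matrix.of_apply, physBasis_interpPoint Ξ hF hξ]

theorem physBasis_interpPoint_pos_iff (Ξ : ∀ k, KnotVector (p k) (n k))
    {F : (Fin d → ℝ) → (Fin d → ℝ)} (hF : Set.InjOn F (Set.Icc 0 1)) {ξ : ∀ k, Fin (n k) → ℝ}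
    (hξ : ∀ k j, ξ k j ∈ Set.Icc (0 : ℝ) 1) :
    (∀ i, 0 < physBasis Ξ F i (interpPoint F ξ i)) ↔ ∀ k j, 0 < (Ξ k).bspline j (ξ k j) := by
  simp only [physBasis_interpPoint Ξ hF hξ]
  refine ⟨fun h k j => ?_, fun h i => Finset.prod_pos fun k _ => h k (i k)⟩
  -- Any multi-index with `k`-th entry `j` serves: its product is nonzero, hence so is the `k`-th
  -- factor.
  have := h (Function.update (fun l => ⟨0, (Ξ l).dim_pos⟩) k j)
  have := Finset.prod_ne_zero_iff.1 this.ne' k (Finset.mem_univ k)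
  rw [Function.update_self] at this
  exact ((Ξ k).bspline_nonneg j _).lt_of_ne' this

/-- A repeated coordinate in direction `k` would give equal points for two multi-indices differing
only there. -/
theorem injective_of_injective_interpPoint (Ξ : ∀ k, KnotVector (p k) (n k))
    {F : (Fin d → ℝ) → (Fin d → ℝ)} {ξ : ∀ k, Fin (n k) → ℝ}
    (h : Function.Injective (interpPoint F ξ)) (k : Fin d) : Function.Injective (ξ k) := by
  intro a b hab
  have := @h (Function.update (fun l => ⟨0, (Ξ l).dim_pos⟩) k a)
    (Function.update (fun l => ⟨0, (Ξ l).dim_pos⟩) k b) (congrArg F (funext fun l => ?_))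
  · simpa using congrFun this k
  · rcases eq_or_ne l k with rfl | hl
    · simpa using hab
    · simp only [Function.update_of_ne hl]

end TensorSpline

end

theorem theorem4p1 {d : ℕ} (p n : Fin d → ℕ)
    (Ξ : ∀ k, TensorSpline.KnotVector (p k) (n k))
    (F : (Fin d → ℝ) → (Fin d → ℝ)) (hF : Set.InjOn F (Set.Icc 0 1))
    (ξ : ∀ k, Fin (n k) → ℝ) (hξ : ∀ k j, ξ k j ∈ Set.Icc (0 : ℝ) 1)
    (hdistinct : Function.Injective (TensorSpline.interpPoint F ξ)) :
    ((∀ i, 0 < TensorSpline.physBasis Ξ F i (TensorSpline.interpPoint F ξ i)) →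
      IsUnit (TensorSpline.collocationMatrix (TensorSpline.physBasis Ξ F)
        (TensorSpline.interpPoint F ξ))) ∧
    ((∀ k, Monotone (ξ k)) →
      (IsUnit (TensorSpline.collocationMatrix (TensorSpline.physBasis Ξ F)
        (TensorSpline.interpPoint F ξ)) ↔
      ∀ i, 0 < TensorSpline.physBasis Ξ F i (TensorSpline.interpPoint F ξ i))) := by
  have hpos := TensorSpline.physBasis_interpPoint_pos_iff Ξ hF hξ
  have sufficient : (∀ i, 0 < TensorSpline.physBasis Ξ F i (TensorSpline.interpPoint F ξ i)) →
      IsUnit (TensorSpline.collocationMatrix (TensorSpline.physBasis Ξ F)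
        (TensorSpline.interpPoint F ξ)) := by
    intro h
    rw [TensorSpline.collocationMatrix_eq_tensorMatrix Ξ hF hξ]
    exact TensorSpline.isUnit_tensorMatrix fun k => (Ξ k).isUnit_collocationMatrix
      (TensorSpline.injective_of_injective_interpPoint Ξ hdistinct k) (fun j => (hξ k j).1)
      (hpos.1 h k)
  refine ⟨sufficient, fun hmono => ⟨fun h => hpos.2 fun k j => ?_, sufficient⟩⟩
  rw [TensorSpline.collocationMatrix_eq_tensorMatrix Ξ hF hξ] at h
  have : ∀ k, Nonempty (Fin (n k)) := fun k => ⟨⟨0, (Ξ k).dim_pos⟩⟩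
  exact (Ξ k).bspline_pos_of_isUnit (hmono k) (TensorSpline.isUnit_of_isUnit_tensorMatrix h k) j
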